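/- Let $\Bbbk$ be an algebraically closed field of characteristic zero and let $L=L_0\oplus L_1$ be a finite-dimensional Lie superalgebra over $\Bbbk$, that is, a finite-dimensional $\mathbb Z/2$-graded $\Bbbk$-vector space with a bilinear bracket such that, for homogeneous $x,y,z$ of degrees $|x|,|y|,|z|$, one has $[L_\alpha,L_\beta]\subseteq L_{\alpha+\beta}$, $[x,y]=-(-1)^{|x||y|}[y,x]$, and $$(-1)^{|x||z|}[x,[y,z]]+(-1)^{|y||x|}[y,[z,x]]+(-1)^{|z||y|}[z,[x,y]]=0 .$$ Let $U(L)$ be its universal enveloping algebra, the quotient of the tensor algebra $T(L)$ by the two-sided ideal generated by all $x\otimes y-(-1)^{|x||y|}y\otimes x-[x,y]$ with $x,y\in L$ homogeneous, and let $\mathcal F=(F_n)_{n\ge 0}$ be its PBW filtration: $F_n$ is the span of all products of at most $n$ elements of $L$. **Theorem.** $U(L)$ is congenial with respect to the PBW filtration $\mathcal F$. Here a $\Bbbk$-algebra $A$ with an $\mathbb N$-filtration $\mathcal F$ (an increasing exhaustive chain of subspaces $F_n$ with $1\in F_0$ and $F_iF_j\subseteq F_{i+j}$) is called congenial if the following hold.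 1. $\mathcal F$ is locally finite: every $F_n$ is finite-dimensional over $\Bbbk$. 2. There are a finitely generated subring $D\subseteq\Bbbk$ and a $D$-subalgebra $A_D\subseteq A$ which is an order of $A$, that is, $A_D$ is free as a $D$-module and the natural map $A_D\otimes_D\Bbbk\to A$ is bijective; and the induced filtration $(A_D\cap F_n)_n$ is locally finite: every $A_D\cap F_n$ is a finitely generated $D$-module. 3. For the same $D$ and $A_D$, the associated graded ring $\operatorname{gr}_{\mathcal F}A_D$ of the induced filtration is, via the natural map $\operatorname{gr}_{\mathcal F}A_D\to\operatorname{gr}_{\mathcal F}A$, an order of $\operatorname{gr}_{\mathcal F}A$: this map is injective, $\operatorname{gr}_{\mathcal F}A_D$ is free over $D$, and $\operatorname{gr}_{\mathcal F}A_D\otimes_D\Bbbk\to\operatorname{gr}_{\mathcal F}A$ is bijective. 4. $\operatorname{gr}_{\mathcal F}A_D$ is strongly noetherian over $D$, that is, $(\operatorname{gr}_{\mathcal F}A_D)\otimes_D C$ is (left and right) noetherian for every commutative noetherian $D$-algebra $C$; and each of its graded pieces is a finitely generated $D$-module. 5. For every factor ring $F$ of $D$ that is a finite field, $A_D\otimes_D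 F$ is a finitely generated, (left and right) noetherian $F$-algebra that satisfies a nonzero polynomial identity over $F$. -/

import Mathlib

open scoped TensorProduct DirectSum

universe u v w

noncomputable section

/-! ### Filtered algebras and their associated graded algebras -/

/-- An `ℕ`-filtration of an associative `R`-algebra `A`: an increasing exhaustive chain of
`R`-submodules `F 0 ≤ F 1 ≤ ...` with `1 ∈ F 0` and `F i * F j ⊆ F (i + j)`. -/
structure AlgFiltration (R : Type u) (A : Type v) [CommRing R] [Ring A] [Algebra R A] where
  F : ℕ → Submodule R A
  mono : Monotone F
  one_mem : (1 : A) ∈ F 0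
  mul_mem : ∀ {i j : ℕ} {a b : A}, a ∈ F i → b ∈ F j → a * b ∈ F (i + j)
  exhaustive : ∀ a : A, ∃ n, a ∈ F n

namespace AlgFiltration

section Gr

variable {R : Type u} {A : Type v} [CommRing R] [Ring A] [Algebra R A] (𝓕 : AlgFiltration R A)

/-- The previous step `F (n - 1)` of the filtration, where `F (-1) = 0`. -/
def prev : ℕ → Submodule R A
  | 0 => ⊥
  | n + 1 => 𝓕.F n

lemma prev_le (n : ℕ) : 𝓕.prev n ≤ 𝓕.F n := by
  cases n with
  | zero => exact bot_le
  | succ n => exact 𝓕.mono (Nat.le_succ n)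

lemma prev_mul_mem {i j : ℕ} {a b : A} (ha : a ∈ 𝓕.prev i) (hb : b ∈ 𝓕.F j) :
    a * b ∈ 𝓕.prev (i + j) := by
  cases i with
  | zero =>
    have h0 : a = 0 := (Submodule.mem_bot R).1 ha
    rw [h0, zero_mul]
    exact zero_mem _
  | succ i =>
    have h1 : a * b ∈ 𝓕.F (i + j) := 𝓕.mul_mem ha hb
    rw [show i + 1 + j = i + j + 1 by omega]
    exact h1

lemma mul_prev_mem {i j : ℕ} {a b : A} (ha : a ∈ 𝓕.F i) (hb : b ∈ 𝓕.prev j) :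
    a * b ∈ 𝓕.prev (i + j) := by
  cases j with
  | zero =>
    have h0 : b = 0 := (Submodule.mem_bot R).1 hb
    rw [h0, mul_zero]
    exact zero_mem _
  | succ j => exact 𝓕.mul_mem ha hb

/-- The degree `n` piece `F n / F (n - 1)` of the associated graded algebra. -/
def GrPiece (n : ℕ) : Type v := 𝓕.F n ⧸ (𝓕.prev n).submoduleOf (𝓕.F n)

instance (n : ℕ) : AddCommGroup (𝓕.GrPiece n) :=
  inferInstanceAs (AddCommGroup (𝓕.F n ⧸ (𝓕.prev n).submoduleOf (𝓕.F n)))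

instance (n : ℕ) : Module R (𝓕.GrPiece n) :=
  inferInstanceAs (Module R (𝓕.F n ⧸ (𝓕.prev n).submoduleOf (𝓕.F n)))

/-- The class of `a ∈ F n` in `F n / F (n - 1)`. -/
def symbol (n : ℕ) (a : A) (ha : a ∈ 𝓕.F n) : 𝓕.GrPiece n :=
  (Submodule.Quotient.mk ⟨a, ha⟩ : 𝓕.F n ⧸ (𝓕.prev n).submoduleOf (𝓕.F n))

lemma symbol_surjective {n : ℕ} (x : 𝓕.GrPiece n) : ∃ a ha, x = 𝓕.symbol n a ha := by
  obtain ⟨⟨a, ha⟩, rfl⟩ := Submodule.Quotient.mk_surjective _ x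
  exact ⟨a, ha, rfl⟩

lemma symbol_eq_zero {n : ℕ} {a : A} {ha : a ∈ 𝓕.F n} :
    𝓕.symbol n a ha = 0 ↔ a ∈ 𝓕.prev n := by
  exact Submodule.Quotient.mk_eq_zero _

lemma symbol_congr {n : ℕ} {a b : A} (h : a = b) (ha : a ∈ 𝓕.F n) (hb : b ∈ 𝓕.F n) :
    𝓕.symbol n a ha = 𝓕.symbol n b hb := by
  subst h
  rfl

/-- A linear map on `F n` which vanishes on `F (n - 1)` descends to `F n / F (n - 1)`. -/
def grPieceLift {M : Type*} [AddCommGroup M] [Module R M] (n : ℕ) (g : 𝓕.F n →ₗ[R] M)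
    (hg : ∀ b : 𝓕.F n, (b : A) ∈ 𝓕.prev n → g b = 0) : 𝓕.GrPiece n →ₗ[R] M :=
  Submodule.liftQ ((𝓕.prev n).submoduleOf (𝓕.F n)) g (fun b hb => hg b hb)

/-- Left multiplication by `a ∈ F i`, as a map `F j → F (i + j)`. -/
def mulLeftPiece (i j : ℕ) (a : 𝓕.F i) : 𝓕.F j →ₗ[R] 𝓕.F (i + j) :=
  ((LinearMap.mulLeft R (a : A)).comp (𝓕.F j).subtype).codRestrict (𝓕.F (i + j))
    (fun b => 𝓕.mul_mem a.2 b.2)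

/-- The product `F i / F (i - 1) × F j / F (j - 1) → F (i + j) / F (i + j - 1)` induced by the
product of `A`. -/
def grMul (i j : ℕ) : 𝓕.GrPiece i →ₗ[R] 𝓕.GrPiece j →ₗ[R] 𝓕.GrPiece (i + j) :=
  Submodule.liftQ _
    { toFun := fun a => Submodule.mapQ _ _ (𝓕.mulLeftPiece i j a)
        (fun b hb => 𝓕.mul_prev_mem a.2 hb)
      map_add' := fun a a' => by
        refine Submodule.linearMap_qext _ (LinearMap.ext fun b => ?_)
        exact congrArg Submodule.Quotient.mk (Subtype.ext (add_mul (a : A) a' b))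
      map_smul' := fun r a => by
        refine Submodule.linearMap_qext _ (LinearMap.ext fun b => ?_)
        exact congrArg Submodule.Quotient.mk (Subtype.ext (smul_mul_assoc r (a : A) b)) }
    (fun a ha => by
      refine LinearMap.mem_ker.2 (Submodule.linearMap_qext _ (LinearMap.ext fun b => ?_))
      exact (Submodule.Quotient.mk_eq_zero _).2 (𝓕.prev_mul_mem ha b.2))

lemma grMul_symbol {i j : ℕ} {a b : A} (ha : a ∈ 𝓕.F i) (hb : b ∈ 𝓕.F j) :
    𝓕.grMul i j (𝓕.symbol i a ha) (𝓕.symbol j b hb) =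
      𝓕.symbol (i + j) (a * b) (𝓕.mul_mem ha hb) := rfl

lemma mk_symbol_eq {i j : ℕ} (hij : i = j) {a b : A} (hab : a = b) (ha : a ∈ 𝓕.F i)
    (hb : b ∈ 𝓕.F j) :
    GradedMonoid.mk (A := 𝓕.GrPiece) i (𝓕.symbol i a ha) = GradedMonoid.mk j (𝓕.symbol j b hb) := by
  subst hij
  subst hab
  rfl

instance grGOne : GradedMonoid.GOne 𝓕.GrPiece where
  one := 𝓕.symbol 0 1 𝓕.one_mem

instance grGMul : GradedMonoid.GMul 𝓕.GrPiece where
  mul {i j} x y := 𝓕.grMul i j x y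

instance grGMonoid : GradedMonoid.GMonoid 𝓕.GrPiece where
  one_mul := by
    rintro ⟨i, x⟩
    obtain ⟨a, ha, rfl⟩ := 𝓕.symbol_surjective x
    exact 𝓕.mk_symbol_eq (zero_add i) (one_mul a) (𝓕.mul_mem 𝓕.one_mem ha) ha
  mul_one := by
    rintro ⟨i, x⟩
    obtain ⟨a, ha, rfl⟩ := 𝓕.symbol_surjective x
    exact 𝓕.mk_symbol_eq (add_zero i) (mul_one a) (𝓕.mul_mem ha 𝓕.one_mem) ha
  mul_assoc := by
    rintro ⟨i, x⟩ ⟨j, y⟩ ⟨l, z⟩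
    obtain ⟨a, ha, rfl⟩ := 𝓕.symbol_surjective x
    obtain ⟨b, hb, rfl⟩ := 𝓕.symbol_surjective y
    obtain ⟨c, hc, rfl⟩ := 𝓕.symbol_surjective z
    exact 𝓕.mk_symbol_eq (add_assoc i j l) (mul_assoc a b c)
      (𝓕.mul_mem (𝓕.mul_mem ha hb) hc) (𝓕.mul_mem ha (𝓕.mul_mem hb hc))

instance grGRing : DirectSum.GRing 𝓕.GrPiece where
  mul_zero {i j} a := (𝓕.grMul i j a).map_zero
  zero_mul {i j} b := by
    change 𝓕.grMul i j 0 b = 0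
    rw [map_zero, LinearMap.zero_apply]
  mul_add {i j} a b c := (𝓕.grMul i j a).map_add b c
  add_mul {i j} a b c := by
    change 𝓕.grMul i j (a + b) c = 𝓕.grMul i j a c + 𝓕.grMul i j b c
    rw [map_add, LinearMap.add_apply]
  natCast n := n • 𝓕.symbol 0 1 𝓕.one_mem
  natCast_zero := zero_smul _ _
  natCast_succ n := succ_nsmul _ n
  intCast n := n • 𝓕.symbol 0 1 𝓕.one_mem
  intCast_ofNat n := natCast_zsmul _ n
  intCast_negSucc_ofNat n := negSucc_zsmul _ n

instance grGAlgebra : DirectSum.GAlgebra R 𝓕.GrPiece where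
  toFun := ((LinearMap.toSpanSingleton R (𝓕.GrPiece 0) (𝓕.symbol 0 1 𝓕.one_mem)).toAddMonoidHom)
  map_one := one_smul R (𝓕.symbol 0 1 𝓕.one_mem)
  map_mul r s := by
    refine 𝓕.mk_symbol_eq (i := 0) (j := 0 + 0) (a := (r * s) • (1 : A)) (b := (r • 1) * (s • 1))
      rfl ?_ (Submodule.smul_mem _ _ 𝓕.one_mem)
      (𝓕.mul_mem (Submodule.smul_mem _ _ 𝓕.one_mem) (Submodule.smul_mem _ _ 𝓕.one_mem))
    rw [smul_mul_smul_comm, one_mul]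
  commutes := by
    rintro r ⟨i, x⟩
    obtain ⟨a, ha, rfl⟩ := 𝓕.symbol_surjective x
    refine 𝓕.mk_symbol_eq (a := (r • (1 : A)) * a) (b := a * (r • 1)) (add_comm 0 i) ?_
      (𝓕.mul_mem (Submodule.smul_mem _ _ 𝓕.one_mem) ha)
      (𝓕.mul_mem ha (Submodule.smul_mem _ _ 𝓕.one_mem))
    rw [smul_mul_assoc, mul_smul_comm, one_mul, mul_one]
  smul_def := by
    rintro r ⟨i, x⟩
    obtain ⟨a, ha, rfl⟩ := 𝓕.symbol_surjective x
    refine 𝓕.mk_symbol_eq (a := r • a) (b := (r • (1 : A)) * a) (zero_add i).symm ?_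
      (Submodule.smul_mem _ _ ha)
      (𝓕.mul_mem (Submodule.smul_mem _ _ 𝓕.one_mem) ha)
    rw [smul_mul_assoc, one_mul]

/-- The associated graded algebra `gr A = ⨁ n, F n / F (n - 1)`. -/
def Gr : Type v := ⨁ n, 𝓕.GrPiece n

instance : Ring 𝓕.Gr := inferInstanceAs (Ring (⨁ n, 𝓕.GrPiece n))

instance : Algebra R 𝓕.Gr := inferInstanceAs (Algebra R (⨁ n, 𝓕.GrPiece n))

/-- The inclusion of the degree `n` piece in `gr A`. -/
def grOf (n : ℕ) : 𝓕.GrPiece n →ₗ[R] 𝓕.Gr := DirectSum.lof R ℕ 𝓕.GrPiece n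

lemma grOf_symbol_mul {i j : ℕ} {a b : A} (ha : a ∈ 𝓕.F i) (hb : b ∈ 𝓕.F j) :
    𝓕.grOf i (𝓕.symbol i a ha) * 𝓕.grOf j (𝓕.symbol j b hb) =
      𝓕.grOf (i + j) (𝓕.symbol (i + j) (a * b) (𝓕.mul_mem ha hb)) :=
  DirectSum.of_mul_of (A := 𝓕.GrPiece) _ _

/-- A filtration is locally finite if each `F n` is a finitely generated `R`-module. -/
def LocallyFinite : Prop := ∀ n, Module.Finite R (𝓕.F n)

/-- The graded algebra `gr A` is locally finite if each graded piece is a finitely generated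
`R`-module. -/
def GrLocallyFinite : Prop := ∀ n, Module.Finite R (𝓕.GrPiece n)

end Gr

section Induced

variable {k : Type u} {A : Type v} [CommRing k] [Ring A] [Algebra k A] (𝓕 : AlgFiltration k A)
  (D : Type u) [CommRing D] [Algebra D k] [Algebra D A] [IsScalarTower D k A] (B : Subalgebra D A)

/-- The filtration `B ∩ F n` induced on a `D`-subalgebra `B` of the filtered algebra `A`. -/
def induced : AlgFiltration D B where
  F n := ((𝓕.F n).restrictScalars D).comap B.val.toLinearMap
  mono _ _ h _ hx := 𝓕.mono h hx
  one_mem := 𝓕.one_mem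
  mul_mem ha hb := 𝓕.mul_mem ha hb
  exhaustive a := 𝓕.exhaustive (a : A)

lemma induced_prev_mem {n : ℕ} {b : B} (hb : b ∈ (𝓕.induced D B).prev n) :
    (b : A) ∈ 𝓕.prev n := by
  cases n with
  | zero =>
    have h0 : b = 0 := (Submodule.mem_bot D).1 hb
    rw [h0]
    exact zero_mem _
  | succ n => exact hb

variable [Algebra D 𝓕.Gr] [IsScalarTower D k 𝓕.Gr]

/-- The natural map `(B ∩ F n) / (B ∩ F (n - 1)) → F n / F (n - 1)`, followed by the inclusion
in `gr A`. -/
def grMapPiece (n : ℕ) : (𝓕.induced D B).GrPiece n →ₗ[D] 𝓕.Gr :=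
  (𝓕.induced D B).grPieceLift n
    { toFun := fun b => 𝓕.grOf n (𝓕.symbol n ((b : B) : A) b.2)
      map_add' := fun b b' => (𝓕.grOf n).map_add (𝓕.symbol n ((b : B) : A) b.2)
        (𝓕.symbol n ((b' : B) : A) b'.2)
      map_smul' := fun r b => by
        have h1 : 𝓕.symbol n (((r • b : (𝓕.induced D B).F n) : B) : A) (r • b).2 =
            algebraMap D k r • 𝓕.symbol n ((b : B) : A) b.2 :=
          𝓕.symbol_congr (algebraMap_smul k r ((b : B) : A)).symm _
            (Submodule.smul_mem _ _ b.2)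
        rw [h1, map_smul, algebraMap_smul, RingHom.id_apply] }
    (fun b hb => by
      have h0 : 𝓕.symbol n ((b : B) : A) b.2 = 0 :=
        𝓕.symbol_eq_zero.2 (𝓕.induced_prev_mem D B hb)
      exact (congrArg (𝓕.grOf n) h0).trans (map_zero _))

lemma grMapPiece_symbol {n : ℕ} {b : B} (hb : b ∈ (𝓕.induced D B).F n) :
    𝓕.grMapPiece D B n ((𝓕.induced D B).symbol n b hb) = 𝓕.grOf n (𝓕.symbol n (b : A) hb) := rfl

/-- The natural `D`-algebra map `gr B → gr A`, for the induced filtration on `B`. -/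
def grMap : (𝓕.induced D B).Gr →ₐ[D] 𝓕.Gr :=
  DirectSum.toAlgebra D (𝓕.induced D B).GrPiece (𝓕.grMapPiece D B)
    (𝓕.grMapPiece_symbol D B (𝓕.induced D B).one_mem) (by
      intro i j x y
      obtain ⟨a, ha, rfl⟩ := (𝓕.induced D B).symbol_surjective x
      obtain ⟨b, hb, rfl⟩ := (𝓕.induced D B).symbol_surjective y
      exact (𝓕.grMapPiece_symbol D B ((𝓕.induced D B).mul_mem ha hb)).trans
        (𝓕.grOf_symbol_mul (i := i) (j := j) (a := (a : A)) (b := (b : A)) ha hb).symm)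

end Induced

end AlgFiltration

/-! ### Congenial algebras -/

/-- A ring is noetherian if it is left and right noetherian. -/
def IsTwoSidedNoetherian (S : Type v) [Ring S] : Prop :=
  IsNoetherianRing S ∧ IsNoetherianRing Sᵐᵒᵖ

/-- The `R`-algebra `S` is strongly noetherian: `S ⊗ C` is noetherian for every commutative
noetherian `R`-algebra `C` (in the universe `w`). -/
def IsStronglyNoetherian (R : Type u) (S : Type v) [CommRing R] [Ring S] [Algebra R S] : Prop :=
  ∀ (C : Type w) [CommRing C] [Algebra R C] [IsNoetherianRing C],
    IsTwoSidedNoetherian (S ⊗[R] C)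

/-- The algebra `S` over the field `K` is PI: it satisfies a nonzero polynomial identity in
noncommuting variables. -/
def IsPIAlgebra (K : Type u) (S : Type v) [Field K] [Ring S] [Algebra K S] : Prop :=
  ∃ f : FreeAlgebra K ℕ, f ≠ 0 ∧ ∀ s : ℕ → S, FreeAlgebra.lift K s f = 0

/-- For a subring `D` of the field `k`, a `k`-algebra `A` and a `D`-algebra `B` with a `D`-algebra
map `f : B → A`: the map `f` identifies `B` with an order of `A`, that is, with a `D`-subalgebra of
`A` which is free over `D` and for which `k ⊗[D] B → A` is bijective. -/
def IsOrderOf {k : Type u} [Field k] (D : Subalgebra ℤ k) {B A : Type v} [Ring B] [Ring A]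
    [Algebra D B] [Algebra k A] (f : B →ₐ[D] A) : Prop :=
  Function.Injective f ∧ Module.Free D B ∧ IsBaseChange k f.toLinearMap

/-- The `k`-algebra `A` is congenial with respect to the filtration `𝓕`. Subrings of `k` which are
affine over `ℤ` are the `D : Subalgebra ℤ k` with `D.FG`; the factor rings of `D` which are finite
fields are the finite rings `D ⧸ I` with `I` maximal. -/
def IsCongenial {k : Type u} {A : Type v} [Field k] [Ring A] [Algebra k A]
    (𝓕 : AlgFiltration k A) : Prop :=
  𝓕.LocallyFinite ∧
  ∃ (D : Subalgebra ℤ k) (B : Subalgebra D A),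
    D.FG ∧
    IsOrderOf D B.val ∧
    (𝓕.induced D B).LocallyFinite ∧
    IsOrderOf D (𝓕.grMap D B) ∧
    IsStronglyNoetherian.{u, v, w} D (𝓕.induced D B).Gr ∧
    (𝓕.induced D B).GrLocallyFinite ∧
    ∀ (I : Ideal D) [I.IsMaximal], Finite (D ⧸ I) →
      letI : Field (D ⧸ I) := Ideal.Quotient.field I
      Algebra.FiniteType (D ⧸ I) ((D ⧸ I) ⊗[D] B) ∧
      IsTwoSidedNoetherian ((D ⧸ I) ⊗[D] B) ∧
      IsPIAlgebra (D ⧸ I) ((D ⧸ I) ⊗[D] B)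

/-! ### Lie superalgebras and their enveloping algebras -/

/-- The sign `(-1) ^ (|x| |y|)` for parities `|x| = i` and `|y| = j`. -/
def superSign (i j : ZMod 2) : ℤ := (-1) ^ (i.val * j.val)

/-- A Lie superalgebra structure on a vector space `L` over the field `k` (of characteristic other
than `2` and `3`): a `ZMod 2`-grading and a bilinear bracket which respects the grading, is super
skew-symmetric and satisfies the super Jacobi identity. -/
structure LieSuperalgebra (k : Type u) (L : Type v) [Field k] [AddCommGroup L] [Module k L] where
  part : ZMod 2 → Submodule k L
  isInternal : DirectSum.IsInternal part
  bracket : L →ₗ[k] L →ₗ[k] L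
  bracket_mem : ∀ {i j : ZMod 2} {x y : L}, x ∈ part i → y ∈ part j → bracket x y ∈ part (i + j)
  skew : ∀ {i j : ZMod 2} {x y : L}, x ∈ part i → y ∈ part j →
    bracket x y = -(superSign i j • bracket y x)
  jacobi : ∀ {i j l : ZMod 2} {x y z : L}, x ∈ part i → y ∈ part j → z ∈ part l →
    superSign i l • bracket x (bracket y z) + superSign j i • bracket y (bracket z x) +
      superSign l j • bracket z (bracket x y) = 0

namespace LieSuperalgebra

variable {k : Type u} {L : Type v} [Field k] [AddCommGroup L] [Module k L]
  (S : LieSuperalgebra k L)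

/-- The relations `x ⊗ y - (-1) ^ (|x| |y|) y ⊗ x = [x, y]`, for `x` and `y` homogeneous, in the
tensor algebra of `L`. -/
inductive EnvRel : TensorAlgebra k L → TensorAlgebra k L → Prop
  | mk {i j : ZMod 2} {x y : L} (hx : x ∈ S.part i) (hy : y ∈ S.part j) :
      EnvRel
        (TensorAlgebra.ι k x * TensorAlgebra.ι k y -
          superSign i j • (TensorAlgebra.ι k y * TensorAlgebra.ι k x))
        (TensorAlgebra.ι k (S.bracket x y))

/-- The universal enveloping algebra `U(L)`: the quotient of the tensor algebra by the two-sided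
ideal generated by the relations. -/
def Env : Type (max u v) := RingQuot S.EnvRel

instance : Ring S.Env := inferInstanceAs (Ring (RingQuot S.EnvRel))

instance : Algebra k S.Env := inferInstanceAs (Algebra k (RingQuot S.EnvRel))

/-- The quotient map from the tensor algebra to `U(L)`. -/
def mkEnv : TensorAlgebra k L →ₐ[k] S.Env := RingQuot.mkAlgHom k S.EnvRel

/-- The canonical map `L → U(L)`. -/
def ι : L →ₗ[k] S.Env := S.mkEnv.toLinearMap.comp (TensorAlgebra.ι k)

lemma one_le_one_sup : (1 : Submodule k S.Env) ≤ 1 ⊔ LinearMap.range S.ι := le_sup_left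

/-- The standard PBW filtration on `U(L)`: `F n = (k + L) ^ n` is the span of all products of at
most `n` elements of `L`. -/
def pbwFiltration : AlgFiltration k S.Env where
  F n := (1 ⊔ LinearMap.range S.ι) ^ n
  mono _ _ h := pow_le_pow_right₀ S.one_le_one_sup h
  one_mem := by
    rw [pow_zero]
    exact Submodule.one_le.1 le_rfl
  mul_mem {i j a b} ha hb := by
    rw [pow_add]
    exact Submodule.mul_mem_mul ha hb
  exhaustive a := by
    obtain ⟨t, rfl⟩ : ∃ t, S.mkEnv t = a := RingQuot.mkAlgHom_surjective k S.EnvRel a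
    induction t using TensorAlgebra.induction with
    | algebraMap r =>
      refine ⟨0, ?_⟩
      rw [AlgHom.commutes, pow_zero]
      exact Submodule.algebraMap_mem r
    | ι x =>
      refine ⟨1, ?_⟩
      rw [pow_one]
      exact Submodule.mem_sup_right ⟨x, rfl⟩
    | mul s t hs ht =>
      obtain ⟨m, hm⟩ := hs
      obtain ⟨n, hn⟩ := ht
      refine ⟨m + n, ?_⟩
      rw [map_mul, pow_add]
      exact Submodule.mul_mem_mul hm hn
    | add s t hs ht =>
      obtain ⟨m, hm⟩ := hs
      obtain ⟨n, hn⟩ := ht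
      refine ⟨max m n, ?_⟩
      rw [map_add]
      exact add_mem (pow_le_pow_right₀ S.one_le_one_sup (le_max_left m n) hm)
        (pow_le_pow_right₀ S.one_le_one_sup (le_max_right m n) hn)

end LieSuperalgebra

end

/-! Let an algebra be filtered by the length of products of finitely many generators which commute
up to signs and lower terms, and order the monomials `x₀ ^ e₀ ⋯ xₙ ^ eₙ` by degree and then
lexicographically. The ordered monomials which are not combinations of smaller ones form a basis
adapted to the filtration; this Gröbner argument replaces the PBW theorem. By sign commutation the
exponents of the other monomials are an upper set of `ℕⁿ`, so by Dickson's lemma all reductions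
follow from finitely many, whose coefficients lie in a finitely generated ring `D`. Over `D` the
same monomials are a basis of the `D`-algebra of the generators, and their symbols are a basis of
its associated graded ring.

In the associated graded ring the generators commute up to signs, so their squares are central and
the ring is finite over a commutative polynomial ring, over every base. Over a finite field of
characteristic `p`, let a power `u` of a generator normalize the span of the generators under
commutators. Since `ad u ^ p ^ m = ad (u ^ p ^ m)` takes finitely many values on this finite space,
some `u ^ p ^ b - u ^ p ^ a` is central, and the algebra is again finite over a polynomial ring; it
then satisfies the standard identity of a large degree. -/

section OrderedMonomials

variable {M : Type*} [Monoid M] {n : ℕ}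

/-- The ordered monomial `x 0 ^ e 0 * ⋯ * x (n - 1) ^ e (n - 1)` in noncommuting variables. -/
def orderedMonomial (x : Fin n → M) (e : Fin n →₀ ℕ) : M :=
  ((List.finRange n).map fun i => x i ^ e i).prod

/-- The nondecreasing word spelling the ordered monomial with exponents `e`. -/
def exponentWord (e : Fin n →₀ ℕ) : List (Fin n) :=
  (List.finRange n).flatMap fun i => List.replicate (e i) i

lemma prod_map_exponentWord (x : Fin n → M) (e : Fin n →₀ ℕ) :
    ((exponentWord e).map x).prod = orderedMonomial x e := by
  rw [exponentWord, orderedMonomial, List.map_flatMap, List.flatMap_def, List.prod_flatten,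
    List.map_map]
  simp [Function.comp_def]

lemma count_exponentWord (e : Fin n →₀ ℕ) (i : Fin n) : (exponentWord e).count i = e i := by
  rw [exponentWord, List.count_flatMap, ← Fin.sum_univ_def]
  simp [List.count_replicate]

lemma length_exponentWord (e : Fin n →₀ ℕ) : (exponentWord e).length = e.degree := by
  rw [exponentWord, List.length_flatMap, ← Fin.sum_univ_def, Finsupp.degree_eq_sum]
  simp

lemma exponentWord_append_perm (e f : Fin n →₀ ℕ) :
    (exponentWord e ++ exponentWord f).Perm (exponentWord (e + f)) := by
  simp [List.perm_iff_count, count_exponentWord]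

lemma exponentWord_single (i : Fin n) : exponentWord (Finsupp.single i 1) = [i] := by
  refine List.perm_singleton.1 (List.perm_iff_count.2 fun j => ?_)
  simp [count_exponentWord, Finsupp.single_apply, List.count_singleton]

lemma orderedMonomial_zero (x : Fin n → M) : orderedMonomial x 0 = 1 := by
  simp [orderedMonomial]

lemma orderedMonomial_single (x : Fin n → M) (i : Fin n) :
    orderedMonomial x (Finsupp.single i 1) = x i := by
  simp [← prod_map_exponentWord, exponentWord_single]

lemma map_orderedMonomial {M' F : Type*} [Monoid M'] [FunLike F M M'] [MonoidHomClass F M M']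
    (f : F) (x : Fin n → M) (e : Fin n →₀ ℕ) :
    f (orderedMonomial x e) = orderedMonomial (f ∘ x) e := by
  simp [orderedMonomial, map_list_prod, Function.comp_def]

lemma orderedMonomial_mem {S : Type*} [SetLike S M] [SubmonoidClass S M] {s : S} {x : Fin n → M}
    (hx : ∀ i, x i ∈ s) (e : Fin n →₀ ℕ) : orderedMonomial x e ∈ s :=
  list_prod_mem fun _ ha => by
    obtain ⟨i, -, rfl⟩ := List.mem_map.1 ha
    exact pow_mem (hx i) _

end OrderedMonomials

section Generators

variable {R A : Type*} [CommRing R] [Ring A] [Algebra R A] {n : ℕ}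

variable (R) in
/-- The span of `1` and the elements `x i`. -/
def genSpan (x : Fin n → A) : Submodule R A :=
  Submodule.span R (insert 1 (Set.range x))

variable (R) in
/-- The elements `x i` commute up to signs, modulo `R`-combinations of the `x l` and constants. -/
def SignCommuting (x : Fin n → A) : Prop :=
  ∀ i j, ∃ s : ℤˣ, x i * x j - s • (x j * x i) ∈ genSpan R x

variable (R) in
/-- Each `x i` has a positive power whose commutators with the `x j` are `R`-combinations of the
`x l` and constants. -/
def PowerNormalizing (x : Fin n → A) : Prop :=
  ∀ i, ∃ r : ℕ, 0 < r ∧ ∀ j, x i ^ r * x j - x j * x i ^ r ∈ genSpan R x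

lemma one_mem_genSpan (x : Fin n → A) : 1 ∈ genSpan R x :=
  Submodule.subset_span (Set.mem_insert _ _)

lemma gen_mem_genSpan (x : Fin n → A) (i : Fin n) : x i ∈ genSpan R x :=
  Submodule.subset_span (Set.mem_insert_of_mem _ ⟨i, rfl⟩)

namespace AlgFiltration

/-- The filtration whose step `F m` is spanned by the products of at most `m` elements `x i`. -/
def IsStandard (𝓕 : AlgFiltration R A) (x : Fin n → A) : Prop :=
  ∀ m, 𝓕.F m = genSpan R x ^ m

namespace IsStandard

variable {𝓕 : AlgFiltration R A} {x : Fin n → A} (h : 𝓕.IsStandard x)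
include h

lemma F_one : 𝓕.F 1 = genSpan R x := by rw [h, pow_one]

lemma gen_mem (i : Fin n) : x i ∈ 𝓕.F 1 := h.F_one ▸ gen_mem_genSpan x i

lemma prod_map_mem (l : List (Fin n)) : (l.map x).prod ∈ 𝓕.F l.length := by
  induction l with
  | nil => exact 𝓕.one_mem
  | cons i l ih =>
    rw [List.map_cons, List.prod_cons, List.length_cons, add_comm]
    exact 𝓕.mul_mem (h.gen_mem i) ih

lemma orderedMonomial_mem (e : Fin n →₀ ℕ) : orderedMonomial x e ∈ 𝓕.F e.degree := by
  rw [← prod_map_exponentWord, ← length_exponentWord]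
  exact h.prod_map_mem _

lemma exists_prod_map_sub_mem_prev (hx : SignCommuting R x) {l l' : List (Fin n)}
    (hl : l.Perm l') : ∃ s : ℤˣ, (l.map x).prod - s • (l'.map x).prod ∈ 𝓕.prev l.length := by
  induction hl with
  | nil => exact ⟨1, by simp⟩
  | @cons i l l' _ ih =>
    obtain ⟨s, hs⟩ := ih
    refine ⟨s, ?_⟩
    have := 𝓕.mul_prev_mem (h.gen_mem i) hs
    rwa [mul_sub, mul_smul_comm, add_comm, ← List.prod_cons, ← List.prod_cons] at this
  | swap i j l =>
    obtain ⟨s, hs⟩ := hx j i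
    refine ⟨s, ?_⟩
    have := 𝓕.prev_mul_mem (i := 2) (h.F_one ▸ hs) (h.prod_map_mem l)
    rw [sub_mul, smul_mul_assoc, mul_assoc, mul_assoc, add_comm] at this
    simpa only [List.map_cons, List.prod_cons, List.length_cons] using this
  | trans h₁ _ ih₁ ih₂ =>
    obtain ⟨s, hs⟩ := ih₁
    obtain ⟨t, ht⟩ := ih₂
    refine ⟨s * t, ?_⟩
    have := add_mem hs (Submodule.smul_of_tower_mem _ s (h₁.length_eq ▸ ht))
    rwa [smul_sub, smul_smul, sub_add_sub_cancel] at this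

lemma exists_orderedMonomial_mul_sub_mem_prev (hx : SignCommuting R x) (e f : Fin n →₀ ℕ) :
    ∃ s : ℤˣ, orderedMonomial x e * orderedMonomial x f - s • orderedMonomial x (e + f) ∈
      𝓕.prev (e + f).degree := by
  have := h.exists_prod_map_sub_mem_prev hx (exponentWord_append_perm e f)
  rwa [List.map_append, List.prod_append, List.length_append, length_exponentWord,
    length_exponentWord, ← map_add, prod_map_exponentWord, prod_map_exponentWord,
    prod_map_exponentWord] at this

lemma gen_mul_orderedMonomial_mem_span (hx : SignCommuting R x) {m : ℕ}
    (hm : 𝓕.F m ≤ Submodule.span R (orderedMonomial x '' {e | e.degree ≤ m})) (i : Fin n)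
    {e : Fin n →₀ ℕ} (he : e.degree ≤ m) : x i * orderedMonomial x e ∈
      Submodule.span R (orderedMonomial x '' {e | e.degree ≤ m + 1}) := by
  obtain ⟨s, hs⟩ := h.exists_orderedMonomial_mul_sub_mem_prev hx (Finsupp.single i 1) e
  rw [orderedMonomial_single, map_add, Finsupp.degree_single, add_comm 1] at hs
  have hlow : 𝓕.prev (e.degree + 1) ≤
      Submodule.span R (orderedMonomial x '' {e | e.degree ≤ m + 1}) :=
    (𝓕.mono he).trans (hm.trans (Submodule.span_mono (Set.image_mono fun _ => Nat.le_succ_of_le)))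
  have htop : orderedMonomial x (Finsupp.single i 1 + e) ∈
      Submodule.span R (orderedMonomial x '' {e | e.degree ≤ m + 1}) :=
    Submodule.subset_span ⟨_, by simpa [add_comm 1] using he, rfl⟩
  have := add_mem (hlow hs) (Submodule.smul_of_tower_mem _ s htop)
  rwa [sub_add_cancel] at this

lemma F_eq_span_orderedMonomial (hx : SignCommuting R x) (m : ℕ) :
    𝓕.F m = Submodule.span R (orderedMonomial x '' {e | e.degree ≤ m}) := by
  refine le_antisymm ?_ (Submodule.span_le.2 ?_)
  · induction m with
    | zero =>
      rw [h, pow_zero, Submodule.one_le]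
      exact Submodule.subset_span ⟨0, by simp, orderedMonomial_zero x⟩
    | succ m ih =>
      rw [h, pow_succ', ← h]
      refine (mul_le_mul_right ih _).trans ?_
      rw [genSpan, Submodule.span_mul_span, Submodule.span_le]
      rintro _ ⟨_, rfl | ⟨i, rfl⟩, _, ⟨e, he, rfl⟩, rfl⟩
      · simp only [one_mul]
        exact Submodule.subset_span ⟨e, Nat.le_succ_of_le he, rfl⟩
      · exact h.gen_mul_orderedMonomial_mem_span hx ih i he
  · rintro _ ⟨e, he, rfl⟩
    exact 𝓕.mono he (h.orderedMonomial_mem e)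

end IsStandard
end AlgFiltration
end Generators

section LeadingMonomials

variable {R A : Type*} [CommRing R] [Ring A] [Algebra R A] {n : ℕ}

variable (R) in
/-- The span of the ordered monomials which are smaller than the one with exponents `e` in the
degree lexicographic order. -/
def lowerSpan (x : Fin n → A) (e : Fin n →₀ ℕ) : Submodule R A :=
  Submodule.span R (orderedMonomial x '' {f | toDegLex f < toDegLex e})

variable (R) in
/-- The exponents of the ordered monomials which are combinations of smaller ones, that is, the
leading exponents of the relations among the ordered monomials. -/
def reducibleExponents (x : Fin n → A) : Set (Fin n →₀ ℕ) :=
  {e | orderedMonomial x e ∈ lowerSpan R x e}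

lemma lowerSpan_mono (x : Fin n → A) {e f : Fin n →₀ ℕ} (h : toDegLex e ≤ toDegLex f) :
    lowerSpan R x e ≤ lowerSpan R x f :=
  Submodule.span_mono (Set.image_mono fun _ hg => lt_of_lt_of_le hg h)

lemma orderedMonomial_mem_lowerSpan (x : Fin n → A) {e f : Fin n →₀ ℕ}
    (h : toDegLex e < toDegLex f) : orderedMonomial x e ∈ lowerSpan R x f :=
  Submodule.subset_span ⟨e, h, rfl⟩

lemma orderedMonomial_mem_span_of_compl_subset {x : Fin n → A} {N : Set (Fin n →₀ ℕ)}
    (hN : Nᶜ ⊆ reducibleExponents R x) (e : Fin n →₀ ℕ) : orderedMonomial x e ∈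
      Submodule.span R (orderedMonomial x '' {f | f ∈ N ∧ toDegLex f ≤ toDegLex e}) := by
  obtain ⟨e, rfl⟩ := ofDegLex.surjective e
  induction e using WellFoundedLT.induction with
  | _ e ih =>
    by_cases he : ofDegLex e ∈ N
    · exact Submodule.subset_span ⟨ofDegLex e, ⟨he, le_rfl⟩, rfl⟩
    · refine (Submodule.span_le.2 ?_ : lowerSpan R x (ofDegLex e) ≤ _) (hN he)
      rintro _ ⟨f, hf, rfl⟩
      refine Submodule.span_mono (Set.image_mono ?_) (ih (toDegLex f) hf)
      exact fun g hg => ⟨hg.1, hg.2.trans (le_of_lt hf)⟩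

/-- In a vanishing linear combination, the largest vector with a nonzero coefficient would lie in
the span of the others. -/
lemma linearIndependent_of_notMem_span_lt {K V ι : Type*} [DivisionRing K] [AddCommGroup V]
    [Module K V] [LinearOrder ι] {b : ι → V}
    (hb : ∀ i, b i ∉ Submodule.span K (b '' {j | j < i})) : LinearIndependent K b := by
  refine linearIndependent_iff.2 fun c hc => ?_
  by_contra hne
  obtain ⟨m, hm, hmax⟩ := c.support.exists_maximal (Finsupp.support_nonempty_iff.2 hne)
  have hlower : Finsupp.linearCombination K b (c.erase m) ∈ Submodule.span K (b '' {j | j < m}) :=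
    (Finsupp.mem_span_image_iff_linearCombination K).2 ⟨c.erase m, fun j hj => by
      obtain ⟨hjm, hj⟩ := Finset.mem_erase.1 (c.support_erase ▸ hj)
      exact lt_of_le_of_ne (le_of_not_gt fun hlt => hlt.not_ge (hmax hj hlt.le)) hjm, rfl⟩
  rw [← Finsupp.single_add_erase m c, map_add, Finsupp.linearCombination_single] at hc
  refine hb m ((Submodule.smul_mem_iff _ (Finsupp.mem_support_iff.1 hm)).1 ?_)
  rw [eq_neg_of_add_eq_zero_left hc]
  exact neg_mem hlower

lemma linearIndependent_orderedMonomial {K : Type*} [Field K] [Algebra K A] (x : Fin n → A) :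
    LinearIndependent K
      fun e : ↥(reducibleExponents K x)ᶜ => orderedMonomial x (e : Fin n →₀ ℕ) := by
  let _ : LinearOrder ↥(reducibleExponents K x)ᶜ :=
    LinearOrder.lift' (fun e => toDegLex (e : Fin n →₀ ℕ))
      (toDegLex.injective.comp Subtype.val_injective)
  refine linearIndependent_of_notMem_span_lt fun e he => e.2 (Submodule.span_mono ?_ he)
  rintro _ ⟨f, hf, rfl⟩
  exact ⟨f, hf, rfl⟩

lemma exists_mem_genSpan_pow {x : Fin n → A}
    (hx : Algebra.adjoin R (Set.range x) = ⊤) (a : A) : ∃ m, a ∈ genSpan R x ^ m := by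
  have hmono : Monotone (genSpan R x ^ ·) := fun _ _ h =>
    pow_le_pow_right₀ (Submodule.one_le.2 (one_mem_genSpan x)) h
  have ha : a ∈ Algebra.adjoin R (Set.range x) := hx ▸ Algebra.mem_top
  induction ha using Algebra.adjoin_induction with
  | mem a ha =>
    refine ⟨1, ?_⟩
    rw [pow_one]
    exact Submodule.subset_span (Set.mem_insert_of_mem _ ha)
  | algebraMap r => exact ⟨0, by rw [pow_zero]; exact Submodule.algebraMap_mem r⟩
  | add a b _ _ ha hb =>
    obtain ⟨i, hi⟩ := ha
    obtain ⟨j, hj⟩ := hb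
    exact ⟨max i j, add_mem (hmono (le_max_left i j) hi) (hmono (le_max_right i j) hj)⟩
  | mul a b _ _ ha hb =>
    obtain ⟨i, hi⟩ := ha
    obtain ⟨j, hj⟩ := hb
    exact ⟨i + j, pow_add (genSpan R x) i j ▸ Submodule.mul_mem_mul hi hj⟩

namespace AlgFiltration

section Adapted

variable {ι : Type*} (𝓕 : AlgFiltration R A) (b : Module.Basis ι R A) (d : ι → ℕ)

/-- The basis `b`, with `b i` of degree `d i`, is adapted to the filtration if each `F m` is spanned
by the basis vectors of degree at most `m`. -/
def Adapted : Prop := ∀ m, 𝓕.F m = Submodule.span R (b '' {i | d i ≤ m})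

end Adapted

namespace IsStandard

variable {𝓕 : AlgFiltration R A} {x : Fin n → A} (h : 𝓕.IsStandard x)
include h

lemma prev_le_lowerSpan (hx : SignCommuting R x) (e : Fin n →₀ ℕ) :
    𝓕.prev e.degree ≤ lowerSpan R x e := by
  rcases hd : e.degree with - | m
  · exact bot_le
  · refine (h.F_eq_span_orderedMonomial hx m).trans_le (Submodule.span_mono (Set.image_mono ?_))
    intro f hf
    exact Finsupp.DegLex.lt_iff.2 (Or.inl (hd ▸ Nat.lt_succ_of_le hf))

lemma orderedMonomial_mul_mem_lowerSpan (hx : SignCommuting R x) (e : Fin n →₀ ℕ)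
    {f : Fin n →₀ ℕ} {a : A} (ha : a ∈ lowerSpan R x f) :
    orderedMonomial x e * a ∈ lowerSpan R x (e + f) := by
  suffices lowerSpan R x f ≤
      (lowerSpan R x (e + f)).comap (LinearMap.mulLeft R (orderedMonomial x e)) from this ha
  refine Submodule.span_le.2 ?_
  rintro _ ⟨g, hg, rfl⟩
  have hlt : toDegLex (e + g) < toDegLex (e + f) := by
    rw [toDegLex_add, toDegLex_add]
    exact add_lt_add_right (show toDegLex g < toDegLex f from hg) _
  obtain ⟨s, hs⟩ := h.exists_orderedMonomial_mul_sub_mem_prev hx e g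
  have := add_mem (lowerSpan_mono x hlt.le (h.prev_le_lowerSpan hx _ hs))
    (Submodule.smul_of_tower_mem _ s (orderedMonomial_mem_lowerSpan x hlt))
  rwa [sub_add_cancel] at this

lemma isUpperSet_reducibleExponents (hx : SignCommuting R x) :
    IsUpperSet (reducibleExponents R x) := by
  rintro e _ hef (he : orderedMonomial x e ∈ lowerSpan R x e)
  obtain ⟨g, rfl⟩ := exists_add_of_le hef
  rw [add_comm]
  obtain ⟨s, hs⟩ := h.exists_orderedMonomial_mul_sub_mem_prev hx g e
  have := Submodule.smul_of_tower_mem _ s⁻¹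
    (sub_mem (h.orderedMonomial_mul_mem_lowerSpan hx g he) (h.prev_le_lowerSpan hx _ hs))
  rwa [sub_sub_cancel, smul_smul, inv_mul_cancel, one_smul] at this

variable {N : Set (Fin n →₀ ℕ)}

lemma F_eq_span_normal (hx : SignCommuting R x) (hN : Nᶜ ⊆ reducibleExponents R x) (m : ℕ) :
    𝓕.F m = Submodule.span R ((fun e : N => orderedMonomial x (e : Fin n →₀ ℕ)) ''
      {e | (e : Fin n →₀ ℕ).degree ≤ m}) := by
  rw [h.F_eq_span_orderedMonomial hx]
  refine le_antisymm (Submodule.span_le.2 ?_) (Submodule.span_mono ?_)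
  · rintro _ ⟨e, he, rfl⟩
    refine Submodule.span_mono ?_ (orderedMonomial_mem_span_of_compl_subset hN e)
    rintro _ ⟨f, ⟨hfN, hf⟩, rfl⟩
    exact ⟨⟨f, hfN⟩, (Finsupp.DegLex.monotone_degree hf).trans he, rfl⟩
  · rintro _ ⟨e, he, rfl⟩
    exact ⟨e, he, rfl⟩

/-- A Gröbner basis argument: the relations rewrite every ordered monomial in terms of those with
exponents in `N`, without raising degrees. -/
lemma exists_adapted_basis (hx : SignCommuting R x) (hN : Nᶜ ⊆ reducibleExponents R x)
    (hli : LinearIndependent R fun e : N => orderedMonomial x (e : Fin n →₀ ℕ)) :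
    ∃ b : Module.Basis N R A, (∀ e, b e = orderedMonomial x (e : Fin n →₀ ℕ)) ∧
      𝓕.Adapted b fun e => (e : Fin n →₀ ℕ).degree := by
  have hspan : ⊤ ≤ Submodule.span R
      (Set.range fun e : N => orderedMonomial x (e : Fin n →₀ ℕ)) := fun a _ => by
    obtain ⟨m, hm⟩ := 𝓕.exhaustive a
    rw [h.F_eq_span_normal hx hN] at hm
    exact Submodule.span_mono (Set.image_subset_range _ _) hm
  let b := Module.Basis.mk hli hspan
  have hb : ⇑b = fun e : N => orderedMonomial x (e : Fin n →₀ ℕ) := Module.Basis.coe_mk hli hspan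
  exact ⟨b, congrFun hb, fun m => hb ▸ h.F_eq_span_normal hx hN m⟩

end IsStandard

section Standard

variable {x : Fin n → A} (hx : Algebra.adjoin R (Set.range x) = ⊤)

/-- The filtration of an algebra generated by the `x i` by the length of products of the `x i`. -/
def standard : AlgFiltration R A where
  F m := genSpan R x ^ m
  mono _ _ h := pow_le_pow_right₀ (Submodule.one_le.2 (one_mem_genSpan x)) h
  one_mem := pow_zero (genSpan R x) ▸ Submodule.one_le.1 le_rfl
  mul_mem ha hb := pow_add (genSpan R x) _ _ ▸ Submodule.mul_mem_mul ha hb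
  exhaustive := exists_mem_genSpan_pow hx

lemma isStandard_standard : (standard hx).IsStandard x := fun _ => rfl

end Standard

end AlgFiltration
end LeadingMonomials

section Subalgebras

variable {R A B : Type*} [CommRing R] [Ring A] [Algebra R A] [Ring B] [Algebra R B] {n : ℕ}
  {f : A →ₐ[R] B} {x : Fin n → A}

lemma map_mem_genSpan_iff (hf : Function.Injective f) {a : A} :
    f a ∈ genSpan R (f ∘ x) ↔ a ∈ genSpan R x := by
  rw [genSpan, genSpan, Set.range_comp, ← map_one f, ← Set.image_insert_eq]
  exact Submodule.apply_mem_span_image_iff_mem_span (f := f.toLinearMap) hf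

lemma SignCommuting.of_injective (hf : Function.Injective f) (h : SignCommuting R (f ∘ x)) :
    SignCommuting R x := fun i j => by
  obtain ⟨s, hs⟩ := h i j
  refine ⟨s, (map_mem_genSpan_iff hf).1 ?_⟩
  simpa [Units.smul_def] using hs

lemma PowerNormalizing.of_injective (hf : Function.Injective f)
    (h : PowerNormalizing R (f ∘ x)) : PowerNormalizing R x := fun i => by
  obtain ⟨r, hr, hc⟩ := h i
  refine ⟨r, hr, fun j => (map_mem_genSpan_iff hf).1 ?_⟩
  simpa using hc j

lemma reducibleExponents_comp (hf : Function.Injective f) :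
    reducibleExponents R (f ∘ x) = reducibleExponents R x := by
  ext e
  have himage (s : Set (Fin n →₀ ℕ)) :
      orderedMonomial (f ∘ x) '' s = f '' (orderedMonomial x '' s) := by
    rw [Set.image_image]
    exact Set.image_congr fun e _ => (map_orderedMonomial f x e).symm
  rw [reducibleExponents, reducibleExponents, Set.mem_ofPred_eq, Set.mem_ofPred_eq, lowerSpan,
    lowerSpan, himage, ← map_orderedMonomial]
  exact Submodule.apply_mem_span_image_iff_mem_span (f := f.toLinearMap) hf

variable (R) in
/-- The elements `x i`, viewed in the subalgebra which they generate. -/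
def adjoinGen (x : Fin n → A) (i : Fin n) : Algebra.adjoin R (Set.range x) :=
  ⟨x i, Algebra.subset_adjoin (Set.mem_range_self i)⟩

lemma adjoin_range_adjoinGen (x : Fin n → A) :
    Algebra.adjoin R (Set.range (adjoinGen R x)) = ⊤ := by
  rw [← Algebra.adjoin_adjoin_coe_preimage (R := R) (s := Set.range x)]
  congr 1
  ext b
  simp [adjoinGen, Subtype.ext_iff]

lemma SignCommuting.adjoinGen (hx : SignCommuting R x) : SignCommuting R (adjoinGen R x) :=
  .of_injective (f := (Algebra.adjoin R (Set.range x)).val) Subtype.val_injective hx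

lemma PowerNormalizing.adjoinGen (hx : PowerNormalizing R x) :
    PowerNormalizing R (adjoinGen R x) :=
  .of_injective (f := (Algebra.adjoin R (Set.range x)).val) Subtype.val_injective hx

lemma reducibleExponents_adjoinGen (x : Fin n → A) :
    reducibleExponents R (adjoinGen R x) = reducibleExponents R x :=
  (reducibleExponents_comp (f := (Algebra.adjoin R (Set.range x)).val)
    Subtype.val_injective).symm

lemma SignCommuting.isUpperSet_reducibleExponents (hx : SignCommuting R x) :
    IsUpperSet (reducibleExponents R x) :=
  reducibleExponents_adjoinGen (R := R) x ▸
    (AlgFiltration.isStandard_standard (adjoin_range_adjoinGen x)).isUpperSet_reducibleExponents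
      hx.adjoinGen

end Subalgebras

section Coefficients

lemma exists_finite_subset_forall_exists_le {α : Type*} [PartialOrder α] [WellQuasiOrderedLE α]
    (U : Set α) : ∃ G ⊆ U, G.Finite ∧ ∀ a ∈ U, ∃ g ∈ G, g ≤ a := by
  refine ⟨{a | Minimal (· ∈ U) a}, fun a ha => ha.prop,
    WellQuasiOrderedLE.finite_of_isAntichain (setOfPred_minimal_antichain _), fun a ha => ?_⟩
  obtain ⟨g, hga, hg⟩ := exists_minimal_le_of_wellFoundedLT (· ∈ U) a ha
  exact ⟨g, hg, hga⟩

variable {k A : Type*} [CommRing k] [Ring A] [Algebra k A]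

lemma isDirectedOrder_fg (R : Type*) [CommRing R] [Algebra R k] :
    IsDirectedOrder {D : Subalgebra R k // D.FG} where
  directed D E := ⟨⟨D ⊔ E, D.2.sup E.2⟩, le_sup_left (a := D.1), le_sup_right (a := D.1)⟩

lemma eventually_mem_span {s : Set A} {a : A} (ha : a ∈ Submodule.span k s) :
    ∀ᶠ D : {D : Subalgebra ℤ k // D.FG} in Filter.atTop, a ∈ Submodule.span D.1 s := by
  have := isDirectedOrder_fg (k := k) ℤ
  induction ha using Submodule.span_induction with
  | mem a ha => exact .of_forall fun D => Submodule.subset_span ha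
  | zero => exact .of_forall fun D => zero_mem _
  | add a b _ _ ha hb =>
    filter_upwards [ha, hb] with D ha hb using add_mem ha hb
  | smul c a _ ha =>
    have hc := Filter.eventually_ge_atTop
      (⟨Algebra.adjoin ℤ {c}, Subalgebra.fg_def.2 ⟨{c}, Set.finite_singleton c, rfl⟩⟩ :
        {D : Subalgebra ℤ k // D.FG})
    filter_upwards [ha, hc] with D ha hc
    exact Submodule.smul_mem _ (⟨c, hc (Algebra.self_mem_adjoin_singleton ℤ c)⟩ : D.1) ha

/-- The relations follow from finitely many, by Dickson's lemma, and these have their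
coefficients in a finitely generated ring. -/
lemma exists_fg_coefficients {n : ℕ} {x : Fin n → A} (hx : SignCommuting k x)
    (hp : PowerNormalizing k x) :
    ∃ D : Subalgebra ℤ k, D.FG ∧ SignCommuting D x ∧ PowerNormalizing D x ∧
      reducibleExponents k x ⊆ reducibleExponents D x := by
  obtain ⟨G, hGU, hG, hle⟩ := exists_finite_subset_forall_exists_le (reducibleExponents k x)
  choose s hs using hx
  choose r hr hc using hp
  have := isDirectedOrder_fg (k := k) ℤ
  have : Nonempty {D : Subalgebra ℤ k // D.FG} := ⟨⟨⊥, Subalgebra.fg_bot⟩⟩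
  have hsign := Filter.eventually_all.2 fun i => Filter.eventually_all.2 fun j =>
    eventually_mem_span (hs i j)
  have hpow := Filter.eventually_all.2 fun i => Filter.eventually_all.2 fun j =>
    eventually_mem_span (hc i j)
  have hred := (Filter.eventually_all_finite hG).2 fun g hg => eventually_mem_span (hGU hg)
  obtain ⟨D, hs, hc, hred⟩ := (hsign.and (hpow.and hred)).exists
  have hxD : SignCommuting D.1 x := fun i j => ⟨s i j, hs i j⟩
  refine ⟨D, D.2, hxD, fun i => ⟨r i, hr i, hc i⟩, fun e he => ?_⟩
  obtain ⟨g, hg, hge⟩ := hle e he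
  exact hxD.isUpperSet_reducibleExponents hge (hred g hg)

end Coefficients

section AdaptedBases

lemma dfinsuppBasis_apply {R ι : Type*} [DecidableEq ι] [Semiring R] {M : ι → Type*}
    [∀ i, AddCommMonoid (M i)] [∀ i, Module R (M i)] {η : ι → Type*}
    (b : ∀ i, Module.Basis (η i) R (M i)) (i : ι) (j : η i) :
    DFinsupp.basis b ⟨i, j⟩ = DFinsupp.single i (b i j) := by
  classical
  refine (DFinsupp.basis b).repr.injective ?_
  rw [Module.Basis.repr_self]
  change _ = (sigmaFinsuppLequivDFinsupp R).symm
    (DFinsupp.mapRange.linearEquiv (fun i => (b i).repr) (DFinsupp.single i (b i j)))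
  rw [LinearEquiv.eq_symm_apply]
  simp

namespace AlgFiltration

variable {R A ι : Type*} [CommRing R] [Ring A] [Algebra R A] {𝓕 : AlgFiltration R A}
  {b : Module.Basis ι R A} {d : ι → ℕ}

lemma LocallyFinite.grLocallyFinite (h : 𝓕.LocallyFinite) : 𝓕.GrLocallyFinite := fun n => by
  have := h n
  exact inferInstanceAs (Module.Finite R (𝓕.F n ⧸ (𝓕.prev n).submoduleOf (𝓕.F n)))

lemma grOf_symbol_congr {i j : ℕ} (hij : i = j) {a b : A} (hab : a = b) (ha : a ∈ 𝓕.F i)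
    (hb : b ∈ 𝓕.F j) : 𝓕.grOf i (𝓕.symbol i a ha) = 𝓕.grOf j (𝓕.symbol j b hb) := by
  subst hij hab
  rfl

namespace Adapted

variable (h : 𝓕.Adapted b d)
include h

lemma basis_mem {i : ι} {m : ℕ} (hi : d i ≤ m) : b i ∈ 𝓕.F m :=
  h m ▸ Submodule.subset_span ⟨i, hi, rfl⟩

lemma mem_F_iff {m : ℕ} {a : A} : a ∈ 𝓕.F m ↔ ∀ i, b.repr a i ≠ 0 → d i ≤ m := by
  rw [h, Module.Basis.mem_span_image]
  simp only [Set.subset_def, Finset.mem_coe, Finsupp.mem_support_iff, Set.mem_ofPred_eq]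

lemma mem_prev_iff {m : ℕ} {a : A} : a ∈ 𝓕.prev m ↔ ∀ i, b.repr a i ≠ 0 → d i < m := by
  cases m with
  | zero =>
    simp only [Nat.not_lt_zero, imp_false, not_not]
    exact b.ext_elem_iff.trans (by simp)
  | succ m => exact h.mem_F_iff.trans (by simp only [Nat.lt_succ_iff])

lemma locallyFinite (hd : ∀ m, {i | d i ≤ m}.Finite) : 𝓕.LocallyFinite := fun m => by
  rw [h]
  exact Module.Finite.span_of_finite R ((hd m).image b)

/-- The coordinates of degree `m`, on `F m / F (m - 1)`. -/
noncomputable def coord (m : ℕ) : 𝓕.GrPiece m →ₗ[R] {i // d i = m} →₀ R :=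
  𝓕.grPieceLift m (Finsupp.lsubtypeDomain {i | d i = m} ∘ₗ b.repr.toLinearMap ∘ₗ (𝓕.F m).subtype)
    fun a ha => Finsupp.ext fun i => by
      by_contra hne
      exact (h.mem_prev_iff.1 ha i hne).ne i.2

lemma coord_symbol {m : ℕ} {a : A} (ha : a ∈ 𝓕.F m) (i : {i // d i = m}) :
    h.coord m (𝓕.symbol m a ha) i = b.repr a i := rfl

lemma coord_symbol_basis {m : ℕ} (i : {i // d i = m}) :
    h.coord m (𝓕.symbol m (b i) (h.basis_mem i.2.le)) = Finsupp.single i 1 := by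
  classical
  ext j
  simp [h.coord_symbol, Finsupp.single_apply, Subtype.ext_iff]

lemma coord_bijective (m : ℕ) : Function.Bijective (h.coord m) := by
  constructor
  · refine (injective_iff_map_eq_zero _).2 fun y hy => ?_
    obtain ⟨a, ha, rfl⟩ := 𝓕.symbol_surjective y
    refine 𝓕.symbol_eq_zero.2 (h.mem_prev_iff.2 fun i hi => ?_)
    exact lt_of_le_of_ne (h.mem_F_iff.1 ha i hi) fun him => hi (DFunLike.congr_fun hy ⟨i, him⟩)
  · rw [← LinearMap.range_eq_top, eq_top_iff, ← Finsupp.basisSingleOne.span_eq,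
      Submodule.span_le]
    rintro _ ⟨i, rfl⟩
    exact ⟨_, (h.coord_symbol_basis i).trans (congrFun Finsupp.coe_basisSingleOne i).symm⟩

/-- The basis of `F m / F (m - 1)` given by the basis vectors of degree `m`. -/
noncomputable def pieceBasis (m : ℕ) : Module.Basis {i // d i = m} R (𝓕.GrPiece m) :=
  .ofRepr (LinearEquiv.ofBijective (h.coord m) (h.coord_bijective m))

lemma pieceBasis_apply (m : ℕ) (i : {i // d i = m}) :
    h.pieceBasis m i = 𝓕.symbol m (b i) (h.basis_mem i.2.le) := by
  refine (h.pieceBasis m).repr.injective ?_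
  rw [Module.Basis.repr_self]
  exact (h.coord_symbol_basis i).symm

/-- The basis of `gr A` given by the symbols of an adapted basis. -/
noncomputable def grBasis : Module.Basis ι R 𝓕.Gr :=
  (DFinsupp.basis h.pieceBasis : Module.Basis (Σ m, {i // d i = m}) R (⨁ m, 𝓕.GrPiece m)).reindex
    (Equiv.sigmaFiberEquiv d)

lemma grBasis_apply (i : ι) :
    h.grBasis i = 𝓕.grOf (d i) (𝓕.symbol (d i) (b i) (h.basis_mem le_rfl)) := by
  rw [← h.pieceBasis_apply (d i) ⟨i, rfl⟩]
  exact (Module.Basis.reindex_apply (M := ⨁ m, 𝓕.GrPiece m) _ _ i).trans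
    (dfinsuppBasis_apply h.pieceBasis (d i) ⟨i, rfl⟩)

end Adapted
end AlgFiltration
end AdaptedBases

section Orders

section BaseChange

variable {D k M N ι : Type*} [CommRing D] [CommRing k] [Algebra D k] [AddCommGroup M] [Module D M]
  [AddCommGroup N] [Module D N] [Module k N] [IsScalarTower D k N] {f : M →ₗ[D] N}
  {b : Module.Basis ι D M} {c : Module.Basis ι k N} (h : ∀ i, f (b i) = c i)
include h

lemma isBaseChange_of_map_basis : IsBaseChange k f := by
  have hf : f = ((Finsupp.linearCombination D c).restrictScalars D).comp
      (b.repr : M →ₗ[D] ι →₀ D) := b.ext fun i => by simp [h]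
  rw [hf]
  exact (IsBaseChange.ofEquiv b.repr).comp (IsBaseChange.of_basis D c)

lemma repr_of_map_basis (a : M) (i : ι) : c.repr (f a) i = algebraMap D k (b.repr a i) := by
  have : (Finsupp.lapply i).comp ((c.repr.toLinearMap.restrictScalars D).comp f) =
      (Algebra.linearMap D k).comp ((Finsupp.lapply i).comp b.repr.toLinearMap) :=
    b.ext fun j => by by_cases hij : j = i <;> simp [h, hij]
  exact LinearMap.congr_fun this a

lemma injective_of_map_basis (hDk : Function.Injective (algebraMap D k)) :
    Function.Injective f := by
  refine (injective_iff_map_eq_zero f).2 fun a ha => b.ext_elem fun i => hDk ?_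
  rw [← repr_of_map_basis h, ha]
  simp

end BaseChange

variable {k : Type u} [Field k] {D : Subalgebra ℤ k} {A : Type v} [Ring A] [Algebra k A]
  {ι : Type*}

lemma isOrderOf_of_map_basis {B : Type v} [Ring B] [Algebra D B] {f : B →ₐ[D] A}
    {b : Module.Basis ι D B} {c : Module.Basis ι k A} (h : ∀ i, f (b i) = c i) :
    IsOrderOf D f :=
  ⟨injective_of_map_basis (f := f.toLinearMap) h Subtype.val_injective, .of_basis b,
    isBaseChange_of_map_basis (f := f.toLinearMap) h⟩

namespace AlgFiltration.Adapted

variable {𝓕 : AlgFiltration k A} {c : Module.Basis ι k A} {d : ι → ℕ} (hc : 𝓕.Adapted c d)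
  {B : Subalgebra D A} {b : Module.Basis ι D B} (h : ∀ i, (b i : A) = c i)
include hc h

lemma induced : (𝓕.induced D B).Adapted b d := fun m => by
  ext a
  rw [Module.Basis.mem_span_image]
  refine hc.mem_F_iff.trans (forall_congr' fun i => ?_)
  rw [repr_of_map_basis (f := B.val.toLinearMap) h, Finset.mem_coe, Finsupp.mem_support_iff,
    map_ne_zero_iff _ (FaithfulSMul.algebraMap_injective D k)]
  rfl

lemma grMap_grBasis (i : ι) : 𝓕.grMap D B ((hc.induced h).grBasis i) = hc.grBasis i := by
  rw [hc.grBasis_apply, (hc.induced h).grBasis_apply]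
  refine (DirectSum.toModule_lof D _ _).trans ?_
  exact (𝓕.grMapPiece_symbol D B _).trans (𝓕.grOf_symbol_congr rfl (h i) _ _)

lemma isOrderOf_grMap : IsOrderOf D (𝓕.grMap D B) :=
  isOrderOf_of_map_basis (hc.grMap_grBasis h)

end AlgFiltration.Adapted
end Orders

namespace AlgFiltration.IsStandard

variable {R A : Type*} [CommRing R] [Ring A] [Algebra R A] {𝓕 : AlgFiltration R A} {n : ℕ}
  {x : Fin n → A} (h : 𝓕.IsStandard x)
include h

/-- The symbols of the generators, of degree one in the associated graded algebra. -/
def grGen (i : Fin n) : 𝓕.Gr :=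
  𝓕.grOf 1 (𝓕.symbol 1 (x i) (h.gen_mem i))

lemma prod_map_grGen (l : List (Fin n)) : (l.map h.grGen).prod =
    𝓕.grOf l.length (𝓕.symbol l.length (l.map x).prod (h.prod_map_mem l)) := by
  induction l with
  | nil => rfl
  | cons i l ih =>
    rw [List.map_cons, List.prod_cons, ih, grGen, grOf_symbol_mul]
    exact grOf_symbol_congr (add_comm _ _) List.prod_cons.symm _ _

lemma orderedMonomial_grGen (e : Fin n →₀ ℕ) : orderedMonomial h.grGen e =
    𝓕.grOf e.degree (𝓕.symbol e.degree (orderedMonomial x e) (h.orderedMonomial_mem e)) := by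
  rw [← prod_map_exponentWord, h.prod_map_grGen]
  exact grOf_symbol_congr (length_exponentWord e) (prod_map_exponentWord x e) _ _

lemma grBasis_eq_orderedMonomial {N : Set (Fin n →₀ ℕ)} {b : Module.Basis N R A}
    (hb : 𝓕.Adapted b fun e => (e : Fin n →₀ ℕ).degree)
    (hbx : ∀ e, b e = orderedMonomial x (e : Fin n →₀ ℕ)) (e : N) :
    hb.grBasis e = orderedMonomial h.grGen (e : Fin n →₀ ℕ) := by
  rw [hb.grBasis_apply, h.orderedMonomial_grGen]
  exact grOf_symbol_congr rfl (hbx e) _ _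

lemma grGen_mul_grGen (hx : SignCommuting R x) (i j : Fin n) :
    ∃ s : ℤˣ, h.grGen i * h.grGen j = s • (h.grGen j * h.grGen i) := by
  obtain ⟨s, hs⟩ := hx i j
  refine ⟨s, ?_⟩
  have hij := 𝓕.mul_mem (h.gen_mem i) (h.gen_mem j)
  have hji := 𝓕.mul_mem (h.gen_mem j) (h.gen_mem i)
  rw [← h.F_one] at hs
  have hsymbol : 𝓕.symbol (1 + 1) (x i * x j) hij -
      (s : ℤ) • 𝓕.symbol (1 + 1) (x j * x i) hji = 0 :=
    (𝓕.symbol_eq_zero (n := 1 + 1) (ha := 𝓕.prev_le (1 + 1) hs)).2 hs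
  rw [grGen, grGen, grOf_symbol_mul, grOf_symbol_mul, sub_eq_zero.1 hsymbol, map_zsmul,
    Units.smul_def]

end AlgFiltration.IsStandard

section FiniteOverCentral

open Polynomial

variable {R S : Type*} [CommRing R] [Ring S] [Algebra R S] {n : ℕ} {x : Fin n → S}

lemma isTwoSidedNoetherian_of_finite (Z S : Type*) [CommRing Z] [IsNoetherianRing Z] [Ring S]
    [Algebra Z S] [Module.Finite Z S] : IsTwoSidedNoetherian S := by
  have : Module.Finite Z Sᵐᵒᵖ := Module.Finite.equiv (MulOpposite.opLinearEquiv Z)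
  exact ⟨isNoetherian_of_tower Z (inferInstanceAs (IsNoetherian Z S)),
    isNoetherian_of_tower Z (inferInstanceAs (IsNoetherian Z Sᵐᵒᵖ))⟩

lemma IsTwoSidedNoetherian.of_ringEquiv {S T : Type*} [Ring S] [Ring T] (e : S ≃+* T)
    (h : IsTwoSidedNoetherian S) : IsTwoSidedNoetherian T :=
  have := h.1
  have := h.2
  ⟨isNoetherianRing_of_ringEquiv S e, isNoetherianRing_of_ringEquiv Sᵐᵒᵖ e.op⟩

lemma adjoin_range_eq_top_of_span_orderedMonomial
    (hspan : Submodule.span R (Set.range (orderedMonomial x)) = ⊤) :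
    Algebra.adjoin R (Set.range x) = ⊤ := by
  rw [← Algebra.toSubmodule_eq_top, eq_top_iff, ← hspan, Submodule.span_le]
  rintro _ ⟨e, rfl⟩
  exact orderedMonomial_mem (fun i => Algebra.subset_adjoin (Set.mem_range_self i)) e

lemma mem_center_of_commute_gen (hx : Algebra.adjoin R (Set.range x) = ⊤) {z : S}
    (hz : ∀ i, Commute z (x i)) : z ∈ Subalgebra.center R S := by
  have hle : (⊤ : Subalgebra R S) ≤ Subalgebra.centralizer R {z} := by
    rw [← hx, Algebra.adjoin_le_iff]
    rintro _ ⟨i, rfl⟩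
    exact Subalgebra.mem_centralizer_iff R |>.2 fun _ h => h ▸ hz i
  exact Subalgebra.mem_center_iff.2 fun y =>
    ((Subalgebra.mem_centralizer_iff R).1 (hle Algebra.mem_top) z rfl).symm

lemma finite_of_isIntegral_of_span_orderedMonomial (hx : ∀ i, IsIntegral R (x i))
    (hspan : Submodule.span R (Set.range (orderedMonomial x)) = ⊤) : Module.Finite R S := by
  let P (l : List (Fin n)) : Submodule R S :=
    (l.map fun i => Subalgebra.toSubmodule (Algebra.adjoin R {x i})).prod
  have hfg (l : List (Fin n)) : (P l).FG := by
    induction l with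
    | nil =>
      simp only [P, List.map_nil, List.prod_nil, Submodule.one_eq_span]
      exact Submodule.fg_span_singleton 1
    | cons i l ih =>
      simp only [P, List.map_cons, List.prod_cons]
      exact (hx i).fg_adjoin_singleton.mul ih
  have hmem (l : List (Fin n)) (e : Fin n →₀ ℕ) : (l.map fun i => x i ^ e i).prod ∈ P l := by
    induction l with
    | nil => exact Submodule.one_le.1 le_rfl
    | cons i l ih =>
      simp only [P, List.map_cons, List.prod_cons]
      exact Submodule.mul_mem_mul (pow_mem (Algebra.self_mem_adjoin_singleton R (x i)) _) ih
  have htop : P (List.finRange n) = ⊤ := by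
    rw [eq_top_iff, ← hspan, Submodule.span_le]
    rintro _ ⟨e, rfl⟩
    exact hmem _ e
  exact ⟨htop ▸ hfg _⟩

lemma exists_algebra_mvPolynomial {z : Fin n → S} (hz : ∀ i, z i ∈ Subalgebra.center R S) :
    ∃ _ : Algebra (MvPolynomial (Fin n) R) S, IsScalarTower R (MvPolynomial (Fin n) R) S ∧
      ∀ i, algebraMap (MvPolynomial (Fin n) R) S (MvPolynomial.X i) = z i := by
  let g : MvPolynomial (Fin n) R →ₐ[R] Subalgebra.center R S :=
    MvPolynomial.aeval fun i => ⟨z i, hz i⟩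
  let f := (Subalgebra.center R S).val.comp g
  let _ : Algebra (MvPolynomial (Fin n) R) S := f.toRingHom.toAlgebra' fun c y =>
    (Subalgebra.mem_center_iff.1 (g c).2 y).symm
  refine ⟨inferInstance, IsScalarTower.of_algebraMap_eq fun r => (f.commutes r).symm, fun i => ?_⟩
  exact congrArg Subtype.val (MvPolynomial.aeval_X _ i)

lemma isIntegral_of_aeval_eq_algebraMap {P : Type*} [CommRing P] [Algebra R P] [Algebra P S]
    [IsScalarTower R P S] {p : R[X]} (hp : p.Monic) (hdeg : p.natDegree ≠ 0) {a : S} {c : P}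
    (h : aeval a p = algebraMap P S c) : IsIntegral P a := by
  nontriviality P
  refine ⟨p.map (algebraMap R P) - C c, (hp.map _).sub_of_left ?_, ?_⟩
  · refine degree_C_le.trans_lt (natDegree_pos_iff_degree_pos.1 ?_)
    rwa [hp.natDegree_map, Nat.pos_iff_ne_zero]
  · rw [eval₂_sub, eval₂_C, ← aeval_def, aeval_map_algebraMap, h, sub_self]

/-- The polynomial ring acts through the central elements `p i (x i)`. -/
lemma exists_finite_mvPolynomial (hspan : Submodule.span R (Set.range (orderedMonomial x)) = ⊤)
    (hx : ∀ i, ∃ p : R[X], p.Monic ∧ p.natDegree ≠ 0 ∧ ∀ j, Commute (aeval (x i) p) (x j)) :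
    ∃ _ : Algebra (MvPolynomial (Fin n) R) S, Module.Finite (MvPolynomial (Fin n) R) S := by
  choose p hp hdeg hcomm using hx
  have hz (i : Fin n) : aeval (x i) (p i) ∈ Subalgebra.center R S :=
    mem_center_of_commute_gen (adjoin_range_eq_top_of_span_orderedMonomial hspan) (hcomm i)
  obtain ⟨_, _, hX⟩ := exists_algebra_mvPolynomial hz
  refine ⟨inferInstance, finite_of_isIntegral_of_span_orderedMonomial (x := x)
    (fun i => isIntegral_of_aeval_eq_algebraMap (hp i) (hdeg i) (hX i).symm) ?_⟩
  exact Submodule.span_eq_top_of_span_eq_top R (MvPolynomial (Fin n) R) _ hspan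

end FiniteOverCentral

section BaseChange

variable {R S : Type*} [CommRing R] [Ring S] [Algebra R S] {n : ℕ} {x : Fin n → S}
  (C : Type*) [CommRing C] [Algebra R C]

lemma span_image_includeRight (s : Set S) :
    Submodule.span C ((Algebra.TensorProduct.includeRight : S →ₐ[R] C ⊗[R] S) '' s) =
      (Submodule.span R s).baseChange C :=
  (Submodule.baseChange_span C s).symm

lemma span_orderedMonomial_includeRight
    (hspan : Submodule.span R (Set.range (orderedMonomial x)) = ⊤) :
    Submodule.span C (Set.range (orderedMonomial
      ((Algebra.TensorProduct.includeRight : S →ₐ[R] C ⊗[R] S) ∘ x))) = ⊤ := by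
  have hcomp : orderedMonomial ((Algebra.TensorProduct.includeRight : S →ₐ[R] C ⊗[R] S) ∘ x) =
      (Algebra.TensorProduct.includeRight : S →ₐ[R] C ⊗[R] S) ∘ orderedMonomial x :=
    funext fun e => (map_orderedMonomial _ x e).symm
  rw [hcomp, Set.range_comp, span_image_includeRight, hspan, Submodule.baseChange_top]

lemma PowerNormalizing.includeRight (hx : PowerNormalizing R x) :
    PowerNormalizing C ((Algebra.TensorProduct.includeRight : S →ₐ[R] C ⊗[R] S) ∘ x) := by
  intro i
  obtain ⟨r, hr, hc⟩ := hx i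
  refine ⟨r, hr, fun j => ?_⟩
  have hmem := Submodule.tmul_mem_baseChange_of_mem (1 : C) (hc j)
  rw [genSpan, ← span_image_includeRight, Set.image_insert_eq, map_one, ← Set.range_comp] at hmem
  simpa [TensorProduct.tmul_sub, Algebra.TensorProduct.tmul_pow, genSpan] using hmem

lemma commute_sq_of_mul_eq_units_smul {a b : S} {s : ℤˣ} (h : a * b = s • (b * a)) :
    Commute (a ^ 2) b := by
  rw [Commute, SemiconjBy, sq, mul_assoc, h, mul_smul_comm, ← mul_assoc, h, smul_mul_assoc,
    smul_smul, Int.units_mul_self, one_smul, mul_assoc]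

lemma isStronglyNoetherian_of_sign_commute
    (hspan : Submodule.span R (Set.range (orderedMonomial x)) = ⊤)
    (hx : ∀ i j, ∃ s : ℤˣ, x i * x j = s • (x j * x i)) : IsStronglyNoetherian.{_, _, w} R S := by
  intro C _ _ _
  refine .of_ringEquiv (Algebra.TensorProduct.comm R C S).toRingEquiv ?_
  rcases subsingleton_or_nontrivial C with hC | hC
  · have : Subsingleton (C ⊗[R] S) := Module.subsingleton C _
    exact ⟨inferInstance, inferInstance⟩
  obtain ⟨_, _⟩ := exists_finite_mvPolynomial (span_orderedMonomial_includeRight C hspan)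
    fun i => ⟨.X ^ 2, Polynomial.monic_X_pow 2, by simp, fun j => by
      obtain ⟨s, hs⟩ := hx i j
      simpa using (commute_sq_of_mul_eq_units_smul hs).map
        (Algebra.TensorProduct.includeRight : S →ₐ[R] C ⊗[R] S)⟩
  exact isTwoSidedNoetherian_of_finite (MvPolynomial (Fin n) C) _

end BaseChange

section StandardPolynomial

variable {A B : Type*} [Ring A] [Ring B] {m : ℕ}

/-- The standard polynomial of degree `m`, the alternating sum of the products of the `v i` in all
orders. -/
def standardPolynomial (v : Fin m → A) : A :=
  ∑ σ : Equiv.Perm (Fin m), Equiv.Perm.sign σ • (List.ofFn (v ∘ σ)).prod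

lemma map_standardPolynomial (f : A →+* B) (v : Fin m → A) :
    f (standardPolynomial v) = standardPolynomial (f ∘ v) := by
  simp [standardPolynomial, Units.smul_def, map_list_prod, List.map_ofFn, Function.comp_assoc]

lemma alternatization_mkPiAlgebraFin_apply (Z : Type*) [CommRing Z] [Algebra Z A]
    (v : Fin m → A) : (MultilinearMap.mkPiAlgebraFin Z m A).alternatization v =
      standardPolynomial v := by
  simp [MultilinearMap.alternatization_apply, standardPolynomial, Function.comp_def]

lemma basisFreeMonoid_apply (R : Type*) {X : Type*} [CommRing R] (w : FreeMonoid X) :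
    FreeAlgebra.basisFreeMonoid R X w = FreeMonoid.lift (FreeAlgebra.ι R) w := by
  simp [FreeAlgebra.basisFreeMonoid, FreeAlgebra.equivMonoidAlgebraFreeMonoid]

lemma linearIndependent_prod_ofFn_ι (R : Type*) {X : Type*} [CommRing R] (m : ℕ) :
    LinearIndependent R fun v : Fin m → X => (List.ofFn (FreeAlgebra.ι R ∘ v)).prod := by
  have hinj : Function.Injective fun v : Fin m → X => FreeMonoid.ofList (List.ofFn v) :=
    FreeMonoid.ofList.injective.comp List.ofFn_injective
  convert (FreeAlgebra.basisFreeMonoid R X).linearIndependent.comp _ hinj using 2 with v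
  simp [basisFreeMonoid_apply, FreeMonoid.lift_apply, List.map_ofFn]

lemma standardPolynomial_ι_ne_zero (R : Type*) {X : Type*} [CommRing R] [Nontrivial R]
    {v : Fin m → X} (hv : Function.Injective v) :
    standardPolynomial (FreeAlgebra.ι R ∘ v) ≠ 0 := by
  intro h
  have hinj : Function.Injective fun σ : Equiv.Perm (Fin m) => v ∘ σ :=
    hv.comp_left.comp DFunLike.coe_injective
  have hli := Fintype.linearIndependent_iff.1 ((linearIndependent_prod_ofFn_ι R m).comp _ hinj)
    (fun σ => ((Equiv.Perm.sign σ : ℤ) : R))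
  have := hli (by simpa [standardPolynomial, Units.smul_def, Int.cast_smul_eq_zsmul,
    Function.comp_assoc] using h) 1
  simp at this

end StandardPolynomial

section FiniteOverCommutative

lemma alternatingMap_eq_zero_of_card_lt {Z M N ι κ : Type*} [CommRing Z] [AddCommGroup M]
    [Module Z M] [AddCommGroup N] [Module Z N] [Fintype ι] [Fintype κ]
    (hcard : Fintype.card κ < Fintype.card ι) {g : κ → M}
    (hg : Submodule.span Z (Set.range g) = ⊤) (f : M [⋀^ι]→ₗ[Z] N) : f = 0 := by
  have hsurj : Function.Surjective (Fintype.linearCombination Z g) := by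
    rw [← LinearMap.range_eq_top, Fintype.range_linearCombination, hg]
  have hcomp : f.compLinearMap (Fintype.linearCombination Z g) = 0 := by
    classical
    exact (Pi.basisFun Z κ).ext_alternating fun v hv =>
      absurd (Fintype.card_le_of_injective v hv) (not_le.2 hcard)
  ext v
  choose t ht using fun i => hsurj (v i)
  simpa [ht] using DFunLike.congr_fun hcomp t

lemma exists_standardPolynomial_eq_zero (Z S : Type*) [CommRing Z] [Ring S] [Algebra Z S]
    [Module.Finite Z S] : ∃ m : ℕ, ∀ v : Fin m → S, standardPolynomial v = 0 := by
  obtain ⟨d, g, hg⟩ := Module.Finite.exists_fin (R := Z) (M := S)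
  refine ⟨d + 1, fun v => ?_⟩
  rw [← alternatization_mkPiAlgebraFin_apply Z]
  exact DFunLike.congr_fun (alternatingMap_eq_zero_of_card_lt (by simp) hg _) v

lemma isPIAlgebra_of_finite (K Z S : Type*) [Field K] [CommRing Z] [Ring S] [Algebra K S]
    [Algebra Z S] [Module.Finite Z S] : IsPIAlgebra K S := by
  obtain ⟨m, hm⟩ := exists_standardPolynomial_eq_zero Z S
  refine ⟨_, standardPolynomial_ι_ne_zero K (Fin.val_injective (n := m)), fun s => ?_⟩
  exact (map_standardPolynomial (FreeAlgebra.lift K s : FreeAlgebra K ℕ →+* S) _).trans (hm _)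

end FiniteOverCommutative

section FiniteField

open Polynomial

variable {K S : Type*} [Field K] [Ring S] [Algebra K S] {n : ℕ} {x : Fin n → S}

lemma commutator_mem_genSpan {u : S} (hu : ∀ j, u * x j - x j * u ∈ genSpan K x) {v : S}
    (hv : v ∈ genSpan K x) : u * v - v * u ∈ genSpan K x := by
  have hle : genSpan K x ≤
      (genSpan K x).comap (LinearMap.mulLeft K u - LinearMap.mulRight K u) := by
    refine Submodule.span_le.2 ?_
    rintro _ (rfl | ⟨j, rfl⟩)
    · simp
    · exact hu j
  exact hle hv

lemma mulLeft_sub_mulRight_pow_char_pow (p : ℕ) [Fact p.Prime] [CharP K p] (u : S) (m : ℕ) :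
    (LinearMap.mulLeft K u - LinearMap.mulRight K u) ^ p ^ m =
      LinearMap.mulLeft K (u ^ p ^ m) - LinearMap.mulRight K (u ^ p ^ m) := by
  rcases subsingleton_or_nontrivial S with hS | hS
  · exact LinearMap.ext fun v => Subsingleton.elim _ _
  have : CharP (Module.End K S) p :=
    charP_of_injective_algebraMap (algebraMap K (Module.End K S)).injective p
  rw [sub_pow_char_pow_of_commute _ _ (LinearMap.commute_mulLeft_right u u),
    LinearMap.pow_mulLeft, LinearMap.pow_mulRight]

/-- The `p`-power powers of `ad u` are the `ad (u ^ p ^ m)`, and only finitely many of them are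
distinct on `V`. -/
lemma exists_commute_pow_sub_pow [Finite K] (p : ℕ) [Fact p.Prime] [CharP K p]
    (V : Submodule K S) [Module.Finite K V] {u : S} (hu : ∀ v ∈ V, u * v - v * u ∈ V) :
    ∃ a b : ℕ, a < b ∧ ∀ v ∈ V, Commute (u ^ p ^ b - u ^ p ^ a) v := by
  have : Finite (Module.End K V) := Module.finite_of_finite K
  have hV : ∀ v ∈ V, (LinearMap.mulLeft K u - LinearMap.mulRight K u) v ∈ V := hu
  let δ : Module.End K V := (LinearMap.mulLeft K u - LinearMap.mulRight K u).restrict hV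
  have hδ (m : ℕ) (v : V) : ((δ ^ p ^ m) v : S) = u ^ p ^ m * v - v * u ^ p ^ m :=
    (congrArg Subtype.val (LinearMap.congr_fun (Module.End.pow_restrict (p ^ m) hV) v)).trans
      (LinearMap.congr_fun (mulLeft_sub_mulRight_pow_char_pow p u m) (v : S))
  obtain ⟨a, b, hlt, hab⟩ := Set.finite_univ.exists_lt_map_eq_of_forall_mem
    (f := fun m : ℕ => δ ^ p ^ m) fun _ => Set.mem_univ _
  refine ⟨a, b, hlt, fun v hv => ?_⟩
  have h := hδ a ⟨v, hv⟩
  rw [show δ ^ p ^ a = δ ^ p ^ b from hab, hδ] at h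
  rwa [Commute, SemiconjBy, sub_mul, mul_sub, sub_eq_sub_iff_sub_eq_sub]

lemma PowerNormalizing.exists_monic_commute [Finite K] (hx : PowerNormalizing K x) (i : Fin n) :
    ∃ p : K[X], p.Monic ∧ p.natDegree ≠ 0 ∧ ∀ j, Commute (aeval (x i) p) (x j) := by
  obtain ⟨p, hp⟩ := CharP.exists K
  have : Fact p.Prime := ⟨CharP.char_is_prime K p⟩
  obtain ⟨r, hr, hc⟩ := hx i
  have : Module.Finite K (genSpan K x) :=
    Module.Finite.span_of_finite K ((Set.finite_range x).insert 1)
  obtain ⟨a, b, hab, hcomm⟩ :=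
    exists_commute_pow_sub_pow p (genSpan K x) fun v => commutator_mem_genSpan hc
  have hlt : r * p ^ a < r * p ^ b :=
    Nat.mul_lt_mul_of_pos_left (Nat.pow_lt_pow_right (Fact.out : p.Prime).one_lt hab) hr
  refine ⟨X ^ (r * p ^ b) - X ^ (r * p ^ a), (monic_X_pow _).sub_of_left ?_, ?_, fun j => ?_⟩
  · rw [degree_X_pow, degree_X_pow]
    exact_mod_cast hlt
  · rw [natDegree_sub_eq_left_of_natDegree_lt (by simpa using hlt), natDegree_X_pow]
    exact Nat.ne_zero_of_lt hlt
  · simpa [pow_mul] using hcomm (x j) (gen_mem_genSpan x j)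

lemma finiteType_noetherian_pi_of_powerNormalizing {R T : Type*} [CommRing R] [Ring T]
    [Algebra R T] {y : Fin n → T} (hspan : Submodule.span R (Set.range (orderedMonomial y)) = ⊤)
    (hy : PowerNormalizing R y) (K : Type*) [Field K] [Finite K] [Algebra R K] :
    Algebra.FiniteType K (K ⊗[R] T) ∧ IsTwoSidedNoetherian (K ⊗[R] T) ∧
      IsPIAlgebra K (K ⊗[R] T) := by
  have hspanK := span_orderedMonomial_includeRight K hspan
  obtain ⟨_, _⟩ := exists_finite_mvPolynomial hspanK (hy.includeRight K).exists_monic_commute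
  exact ⟨⟨Subalgebra.fg_def.2 ⟨_, Set.finite_range _,
      adjoin_range_eq_top_of_span_orderedMonomial hspanK⟩⟩,
    isTwoSidedNoetherian_of_finite (MvPolynomial (Fin n) K) _,
    isPIAlgebra_of_finite K (MvPolynomial (Fin n) K) _⟩

end FiniteField

section Congenial

lemma span_orderedMonomial_eq_top {R A : Type*} [CommRing R] [Ring A] [Algebra R A] {n : ℕ}
    {x : Fin n → A} {N : Set (Fin n →₀ ℕ)} {b : Module.Basis N R A}
    (hb : ∀ e, b e = orderedMonomial x (e : Fin n →₀ ℕ)) :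
    Submodule.span R (Set.range (orderedMonomial x)) = ⊤ := by
  rw [eq_top_iff, ← b.span_eq]
  refine Submodule.span_mono ?_
  rintro _ ⟨e, rfl⟩
  exact ⟨e, (hb e).symm⟩

lemma linearIndependent_orderedMonomial_adjoinGen {D k A : Type*} [CommRing D] [Field k] [Ring A]
    [Algebra D k] [FaithfulSMul D k] [Algebra k A] [Algebra D A] [IsScalarTower D k A] {n : ℕ}
    (x : Fin n → A) : LinearIndependent D fun e : ↥(reducibleExponents k x)ᶜ =>
      orderedMonomial (adjoinGen D x) (e : Fin n →₀ ℕ) := by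
  have hli := (linearIndependent_orderedMonomial (K := k) x).restrict_scalars' D
  refine .of_comp (Algebra.adjoin D (Set.range x)).val.toLinearMap ?_
  convert hli using 2 with e
  exact map_orderedMonomial (Algebra.adjoin D (Set.range x)).val (adjoinGen D x) e

variable {k : Type u} {A : Type v} [Field k] [Ring A] [Algebra k A] {n : ℕ} {x : Fin n → A}
  {𝓕 : AlgFiltration k A}

namespace AlgFiltration.IsStandard

theorem isCongenial (h : 𝓕.IsStandard x) (hx : SignCommuting k x) (hp : PowerNormalizing k x) :
    IsCongenial.{u, v, w} 𝓕 := by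
  obtain ⟨D, hD, hxD, hpD, hred⟩ := exists_fg_coefficients hx hp
  obtain ⟨c, hcx, hc⟩ := h.exists_adapted_basis hx (compl_compl _).subset
    (linearIndependent_orderedMonomial x)
  obtain ⟨b, hbx, hb⟩ := (isStandard_standard (adjoin_range_adjoinGen x)).exists_adapted_basis
    hxD.adjoinGen ((compl_compl _).trans_subset (hred.trans (reducibleExponents_adjoinGen x).ge))
    (linearIndependent_orderedMonomial_adjoinGen (k := k) x)
  have hbc e : (b e : A) = c e := by
    rw [hbx, hcx]
    exact map_orderedMonomial (Algebra.adjoin D (Set.range x)).val _ _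
  have hB := hc.induced hbc
  have hstd : (𝓕.induced D _).IsStandard (adjoinGen D x) := fun m => (hB m).trans (hb m).symm
  have hfin (m : ℕ) : {e : ↥(reducibleExponents k x)ᶜ | (e : Fin n →₀ ℕ).degree ≤ m}.Finite :=
    (Finsupp.finite_of_degree_le m).preimage Subtype.val_injective.injOn
  refine ⟨hc.locallyFinite hfin, D, _, hD, isOrderOf_of_map_basis hbc, hB.locallyFinite hfin,
    hc.isOrderOf_grMap hbc, ?_, (hB.locallyFinite hfin).grLocallyFinite, fun I _ _ => ?_⟩
  · exact isStronglyNoetherian_of_sign_commute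
      (span_orderedMonomial_eq_top (hstd.grBasis_eq_orderedMonomial hB hbx))
      (hstd.grGen_mul_grGen hxD.adjoinGen)
  · let _ : Field (D ⧸ I) := Ideal.Quotient.field I
    exact finiteType_noetherian_pi_of_powerNormalizing (span_orderedMonomial_eq_top hbx)
      hpD.adjoinGen (D ⧸ I)

end AlgFiltration.IsStandard
end Congenial

namespace LieSuperalgebra

variable {k : Type u} {L : Type v} [Field k] [AddCommGroup L] [Module k L]
  (S : LieSuperalgebra k L)

lemma exists_homogeneous_basis [Module.Finite k L] :
    ∃ (n : ℕ) (b : Module.Basis (Fin n) k L) (p : Fin n → ZMod 2), ∀ i, b i ∈ S.part (p i) := by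
  let b := S.isInternal.collectedBasis fun i => Module.finBasis k (S.part i)
  let e := Fintype.equivFin (Σ i, Fin (Module.finrank k (S.part i)))
  refine ⟨_, b.reindex e, fun i => (e.symm i).1, fun i => ?_⟩
  rw [Module.Basis.reindex_apply]
  exact S.isInternal.collectedBasis_mem _ _

lemma ι_mul_sub {i j : ZMod 2} {x y : L} (hx : x ∈ S.part i) (hy : y ∈ S.part j) :
    S.ι x * S.ι y - superSign i j • (S.ι y * S.ι x) = S.ι (S.bracket x y) := by
  have h : S.mkEnv _ = S.mkEnv _ := RingQuot.mkAlgHom_rel k (EnvRel.mk hx hy)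
  simp only [map_sub, map_zsmul, map_mul] at h
  exact h

lemma ι_sq_mul_sub {j : ZMod 2} {x y : L} (hx : x ∈ S.part 1) (hy : y ∈ S.part j) :
    S.ι x ^ 2 * S.ι y - S.ι y * S.ι x ^ 2 = S.ι (S.bracket x (S.bracket x y)) := by
  have hsign (j : ZMod 2) : superSign 1 (1 + j) = -superSign 1 j ∧
      superSign 1 j * superSign 1 j = 1 := by
    revert j
    decide
  rw [← S.ι_mul_sub hx (S.bracket_mem hx hy), ← S.ι_mul_sub hx hy, (hsign j).1]
  have hs : superSign 1 j • superSign 1 j • (S.ι y * S.ι x * S.ι x) = S.ι y * S.ι x * S.ι x := by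
    rw [smul_smul, (hsign j).2, one_smul]
  simp only [mul_sub, sub_mul, smul_mul_assoc, mul_smul_comm, smul_sub, neg_smul, sq, ← mul_assoc,
    hs]
  abel

section Generators

variable {n : ℕ} (b : Module.Basis (Fin n) k L)

lemma one_sup_range_ι : 1 ⊔ LinearMap.range S.ι = genSpan k (S.ι ∘ b) := by
  rw [genSpan, Submodule.span_insert, ← Submodule.one_eq_span, Set.range_comp, ← Submodule.map_span,
    b.span_eq, LinearMap.range_eq_map]

lemma isStandard_pbwFiltration : S.pbwFiltration.IsStandard (S.ι ∘ b) := fun m =>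
  congrArg (· ^ m) (S.one_sup_range_ι b)

lemma ι_mem_genSpan (z : L) : S.ι z ∈ genSpan k (S.ι ∘ b) :=
  S.one_sup_range_ι b ▸ Submodule.mem_sup_right ⟨z, rfl⟩

variable {b} {p : Fin n → ZMod 2} (hb : ∀ i, b i ∈ S.part (p i))
include hb

lemma signCommuting_ι : SignCommuting k (S.ι ∘ b) := fun i j => by
  refine ⟨(-1) ^ ((p i).val * (p j).val), ?_⟩
  have h := S.ι_mul_sub (hb i) (hb j)
  rw [Units.smul_def, Units.val_pow_eq_pow_val, Units.val_neg, Units.val_one]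
  exact h ▸ S.ι_mem_genSpan b _

/-- For odd `x` the square serves, since `[x ^ 2, y] = [x, [x, y]]`. -/
lemma powerNormalizing_ι : PowerNormalizing k (S.ι ∘ b) := fun i => by
  have hi := hb i
  have hp (a : ZMod 2) : a = 0 ∨ a = 1 := by
    revert a
    decide
  rcases hp (p i) with h | h <;> rw [h] at hi
  · refine ⟨1, Nat.one_pos, fun j => ?_⟩
    have hij := S.ι_mul_sub hi (hb j)
    rw [superSign, ZMod.val_zero, zero_mul, pow_zero, one_smul] at hij
    simpa only [Function.comp_apply, pow_one, hij] using S.ι_mem_genSpan b _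
  · refine ⟨2, Nat.two_pos, fun j => ?_⟩
    simpa only [Function.comp_apply, S.ι_sq_mul_sub hi (hb j)] using S.ι_mem_genSpan b _

end Generators
end LieSuperalgebra

theorem mainTheorem4_general {k : Type u} [Field k] {L : Type v} [AddCommGroup L] [Module k L]
    [Module.Finite k L] (S : LieSuperalgebra k L) :
    IsCongenial.{u, max u v, w} S.pbwFiltration := by
  obtain ⟨_, b, _, hb⟩ := S.exists_homogeneous_basis
  exact (S.isStandard_pbwFiltration b).isCongenial (S.signCommuting_ι hb) (S.powerNormalizing_ι hb)

theorem mainTheorem4 {k : Type u} [Field k] [IsAlgClosed k] [CharZero k]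
    {L : Type v} [AddCommGroup L] [Module k L] [Module.Finite k L]
    (S : LieSuperalgebra k L) :
    IsCongenial.{u, max u v, w} S.pbwFiltration :=
  mainTheorem4_general S
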